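/- For a finite simple graph $G=(V,E)$ with a chosen linear order on $V$, a marking of $G$ is a map $m\colon V\to\{0,1,2\}$ such that $m^{-1}(\{1,2\})$ is an independent set. Let $T_{i,j}(G)$ be the free abelian group on the markings with $|m^{-1}(\{1,2\})|=i$ and $|m^{-1}(2)|=j$, and let $d\colon T_{i,j}(G)\to T_{i-1,j}(G)$ be given by $$ d\,m=\sum_{v\in m^{-1}(1)}(-1)^{\#\{w\in m^{-1}(1)\,\mid\, w<v\}}\; m_{v\mapsto 0}, $$ where $m_{v\mapsto 0}$ is $m$ with the label of $v$ changed to $0$. Then $d^2=0$; put $E^1_{p,q}:=H_p(T_{\bullet,q}(G),d)$. For $U\subseteq V$ let $N[U]$ be the union of $U$ and the set of all neighbors of vertices of $U$, and let $G-N[U]$ be the subgraph of $G$ induced on $V\setminus N[U]$. Let $\mathrm{Ind}(H)$ be the simplicial complex of independent sets of a graph $H$, and let $\tilde H_n$ denote reduced simplicial homology with integer coefficients, that is, the homology of the augmented simplicial chain complex, in which the empty simplex has degree $-1$ (so $\tilde H_{-1}(\mathrm{Ind}(\emptyset))\cong\mathbb{Z}$). Theorem. Let $G$ be a path (on $n\ge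 1$ vertices) or a cycle (on $n\ge 3$ vertices), and let $p\ge 0$ be an integer. Then $E^1_{p,p}\cong 0$ if and only if $G$ has no maximal (with respect to inclusion) independent set of cardinality $p$; and if this is the case, then for every integer $q>0$ one has $$E^1_{p,q}\cong 0,$$ and $$\tilde H_{p-q-1}\bigl(\mathrm{Ind}(G-N[U])\bigr)\cong 0$$ for every independent set $U\subseteq V$ with $|U|=q$. -/

import Mathlib

open CategoryTheory

namespace IndepHomology

/-! ### Signs -/

section Signs

variable {V : Type*} [LinearOrder V]

/-- The sign `(-1) ^ #{w ∈ s | w < v}`. -/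
def sgn (s : Finset V) (v : V) : ℤ := (-1) ^ (s.filter (· < v)).card

theorem sgn_erase_self (s : Finset V) {u v : V} (h : v < u) : sgn (s.erase u) v = sgn s v := by
  unfold sgn
  congr 2
  ext w
  simp only [Finset.mem_filter, Finset.mem_erase]
  constructor
  · rintro ⟨⟨_, hs⟩, hw⟩
    exact ⟨hs, hw⟩
  · rintro ⟨hs, hw⟩
    exact ⟨⟨(hw.trans h).ne, hs⟩, hw⟩

theorem sgn_erase_neg (s : Finset V) {u v : V} (hu : u ∈ s) (h : u < v) :
    sgn (s.erase u) v = - sgn s v := by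
  unfold sgn
  have h1 : (s.erase u).filter (· < v) = (s.filter (· < v)).erase u := by
    ext w
    simp only [Finset.mem_filter, Finset.mem_erase]
    tauto
  have h2 : u ∈ s.filter (· < v) := by simp [hu, h]
  rw [h1, ← Finset.card_erase_add_one h2, pow_succ]
  ring

theorem sgn_swap (s : Finset V) {u v : V} (hu : u ∈ s) (hv : v ∈ s) (h : u ≠ v) :
    sgn s v * sgn (s.erase v) u = - (sgn s u * sgn (s.erase u) v) := by
  rcases lt_or_gt_of_ne h with h | h
  · rw [sgn_erase_self s h, sgn_erase_neg s hu h]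
    ring
  · rw [sgn_erase_self s h, sgn_erase_neg s hv h]
    ring

/-- The cancellation behind the fact that boundary maps square to zero. -/
theorem sum_sgn_eq_zero {M : Type*} [AddCommGroup M] (s : Finset V) (g : V → V → M)
    (hg : ∀ v ∈ s, ∀ u ∈ s, u ≠ v → g v u = g u v) :
    ∑ v ∈ s, sgn s v • ∑ u ∈ s.erase v, sgn (s.erase v) u • g v u = 0 := by
  simp only [Finset.smul_sum, smul_smul]
  rw [Finset.sum_sigma']
  refine Finset.sum_involution (fun x _ => ⟨x.2, x.1⟩) ?_ ?_ ?_ ?_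
  · rintro ⟨v, u⟩ hx
    simp only [Finset.mem_sigma, Finset.mem_erase] at hx
    obtain ⟨hv, hne, hu⟩ := hx
    simp only
    rw [sgn_swap s hu hv hne, hg v hv u hu hne, neg_smul, neg_add_cancel]
  · rintro ⟨v, u⟩ hx _ heq
    simp only [Finset.mem_sigma, Finset.mem_erase] at hx
    simp only [Sigma.mk.injEq] at heq
    exact hx.2.1 heq.1
  · rintro ⟨v, u⟩ hx
    simp only [Finset.mem_sigma, Finset.mem_erase] at hx ⊢
    exact ⟨hx.2.2, hx.2.1.symm, hx.1⟩
  · rintro ⟨v, u⟩ _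
    rfl

end Signs

/-! ### Reduced simplicial homology of an abstract simplicial complex -/

section Simplicial

variable {V : Type*} [LinearOrder V]

/-- The simplicial boundary map `∂ s = ∑ v ∈ s, (-1) ^ #{w ∈ s | w < v} (s \ {v})` on the free
abelian group on all finite subsets of `V`; it sends every one-point set to `∅`. -/
noncomputable def boundary : (Finset V →₀ ℤ) →ₗ[ℤ] (Finset V →₀ ℤ) :=
  Finsupp.linearCombination ℤ fun s : Finset V =>
    ∑ v ∈ s, sgn s v • Finsupp.single (s.erase v) (1 : ℤ)

theorem boundary_single (s : Finset V) :
    boundary (Finsupp.single s (1 : ℤ)) =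
      ∑ v ∈ s, sgn s v • Finsupp.single (s.erase v) (1 : ℤ) := by
  simp [boundary]

theorem boundary_boundary : (boundary (V := V)) ∘ₗ boundary = 0 := by
  refine Finsupp.lhom_ext' fun s => LinearMap.ext_ring ?_
  simp only [LinearMap.comp_apply, Finsupp.lsingle_apply, boundary_single, map_sum, map_smul,
    LinearMap.zero_apply]
  refine sum_sgn_eq_zero s (fun v u => Finsupp.single ((s.erase v).erase u) (1 : ℤ)) ?_
  intro v _ u _ _
  simp only [Finset.erase_right_comm]

/-- The augmented chain group in degree `n ∈ ℤ`: the free abelian group on the faces with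
`n + 1` vertices, where the empty set counts as a face (of dimension `-1`). -/
def augChains (K : AbstractSimplicialComplex V) (n : ℤ) : Submodule ℤ (Finset V →₀ ℤ) :=
  Finsupp.supported ℤ ℤ {s : Finset V | (s = ∅ ∨ s ∈ K.faces) ∧ (s.card : ℤ) = n + 1}

theorem boundary_mem (K : AbstractSimplicialComplex V) (n : ℤ) (x : Finset V →₀ ℤ)
    (hx : x ∈ augChains K (n + 1)) : boundary x ∈ augChains K n := by
  have hle : augChains K (n + 1) ≤ (augChains K n).comap boundary := by
    rw [augChains, Finsupp.supported_eq_span_single, Submodule.span_le]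
    rintro _ ⟨s, ⟨hs, hc⟩, rfl⟩
    simp only [SetLike.mem_coe, Submodule.mem_comap]
    rw [boundary_single]
    refine Submodule.sum_mem _ fun v hv => Submodule.smul_mem _ _ ?_
    refine Finsupp.single_mem_supported ℤ _ ⟨?_, ?_⟩
    · rcases Finset.eq_empty_or_nonempty (s.erase v) with h | h
      · exact Or.inl h
      · rcases hs with rfl | hs
        · simp at hv
        · exact Or.inr ((K.isRelLowerSet_faces hs).2 (Finset.erase_subset v s) h)
    · have := Finset.card_erase_add_one hv
      omega
  exact hle hx

/-- The boundary map between the augmented chain groups. -/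
noncomputable def augBoundary (K : AbstractSimplicialComplex V) (n : ℤ) :
    augChains K (n + 1) →ₗ[ℤ] augChains K n :=
  boundary.restrict (boundary_mem K n)

/-- The augmented simplicial chain complex of `K`. -/
noncomputable def augChainComplex (K : AbstractSimplicialComplex V) :
    ChainComplex (ModuleCat ℤ) ℤ :=
  ChainComplex.of (fun n => ModuleCat.of ℤ (augChains K n))
    (fun n => ModuleCat.ofHom (augBoundary K n))
    (fun n => by
      refine ModuleCat.hom_ext (LinearMap.ext fun x => Subtype.ext ?_)
      exact LinearMap.congr_fun boundary_boundary (x : Finset V →₀ ℤ))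

/-- The reduced simplicial homology group of `K` in degree `n ∈ ℤ`, with integer coefficients. -/
noncomputable def reducedHomology (K : AbstractSimplicialComplex V) (n : ℤ) : ModuleCat ℤ :=
  (augChainComplex K).homology n

end Simplicial

/-! ### Independence complexes and deletion of closed neighborhoods -/

section Graphs

variable {V : Type*}

/-- The independence complex of `G`. -/
def indComplex (G : SimpleGraph V) : AbstractSimplicialComplex V where
  faces := {s : Finset V | s.Nonempty ∧ G.IsIndepSet (s : Set V)}
  isRelLowerSet_faces := fun _ hs =>
    ⟨hs.1, fun _ hts ht => ⟨ht, Set.Pairwise.mono (Finset.coe_subset.mpr hts) hs.2⟩⟩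
  singleton_mem := fun v => ⟨Finset.singleton_nonempty v, by simp [SimpleGraph.IsIndepSet]⟩

/-- The closed neighborhood `N[U]`: the union over `v ∈ U` of `{v}` and the neighbors of `v`. -/
def closedNbhd (G : SimpleGraph V) (U : Set V) : Set V :=
  ⋃ v ∈ U, insert v (G.neighborSet v)

/-- The graph `G - N[U]`, i.e. the subgraph of `G` induced on the complement of `N[U]`. -/
abbrev deleteClosedNbhd (G : SimpleGraph V) (U : Set V) :
    SimpleGraph ((closedNbhd G U)ᶜ : Set V) :=
  G.induce (closedNbhd G U)ᶜ

/-- `I` is a maximal (with respect to inclusion) independent set of `G`. -/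
def IsMaximalIndepSet (G : SimpleGraph V) (I : Finset V) : Prop :=
  Maximal (fun J : Finset V => G.IsIndepSet (J : Set V)) I

/-- `G` is a path (on `n ≥ 1` vertices). -/
def IsPathGraph (G : SimpleGraph V) : Prop :=
  ∃ n : ℕ, 1 ≤ n ∧ Nonempty (G ≃g SimpleGraph.pathGraph n)

/-- `G` is a cycle (on `n ≥ 3` vertices). -/
def IsCycleGraph (G : SimpleGraph V) : Prop :=
  ∃ n : ℕ, 3 ≤ n ∧ Nonempty (G ≃g SimpleGraph.cycleGraph n)

end Graphs

/-! ### Markings -/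

section Markings

variable {V : Type*} [Fintype V] [LinearOrder V]

/-- The set of vertices which `m` marks by `1`. -/
def oneMarked (m : V → Fin 3) : Finset V := Finset.univ.filter (fun v => m v = 1)

/-- The set of vertices which `m` marks by `2`. -/
def twoMarked (m : V → Fin 3) : Finset V := Finset.univ.filter (fun v => m v = 2)

/-- The set of vertices which `m` marks by `1` or `2`. -/
def marked (m : V → Fin 3) : Finset V := Finset.univ.filter (fun v => m v = 1 ∨ m v = 2)

/-- A map `m : V → {0, 1, 2}` is a marking of `G` if its marked vertices are independent. -/
def IsMarking (G : SimpleGraph V) (m : V → Fin 3) : Prop :=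
  G.IsIndepSet (marked m : Set V)

/-- `T_{i,j}(G)`: the free abelian group on the markings of `G` with `i` marked vertices, of which
`j` are marked by `2`. -/
def T (G : SimpleGraph V) (i j : ℕ) : Submodule ℤ ((V → Fin 3) →₀ ℤ) :=
  Finsupp.supported ℤ ℤ
    {m : V → Fin 3 | IsMarking G m ∧ (marked m).card = i ∧ (twoMarked m).card = j}

/-- The map `d m = ∑ v ∈ V₁, (-1) ^ #{w ∈ V₁ | w < v} m_{v ↦ 0}`, where `V₁ = m⁻¹(1)`. -/
noncomputable def markD : ((V → Fin 3) →₀ ℤ) →ₗ[ℤ] ((V → Fin 3) →₀ ℤ) :=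
  Finsupp.linearCombination ℤ fun m : V → Fin 3 =>
    ∑ v ∈ oneMarked m, sgn (oneMarked m) v • Finsupp.single (Function.update m v 0) (1 : ℤ)

theorem markD_single (m : V → Fin 3) :
    markD (Finsupp.single m (1 : ℤ)) =
      ∑ v ∈ oneMarked m,
        sgn (oneMarked m) v • Finsupp.single (Function.update m v 0) (1 : ℤ) := by
  simp [markD]

theorem oneMarked_update (m : V → Fin 3) (v : V) :
    oneMarked (Function.update m v 0) = (oneMarked m).erase v := by
  ext w
  by_cases h : w = v
  · subst h
    simp [oneMarked]
  · simp [oneMarked, h]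

theorem marked_update (m : V → Fin 3) (v : V) :
    marked (Function.update m v 0) = (marked m).erase v := by
  ext w
  by_cases h : w = v
  · subst h
    simp [marked]
  · simp [marked, h]

theorem twoMarked_update (m : V → Fin 3) {v : V} (hv : v ∈ oneMarked m) :
    twoMarked (Function.update m v 0) = twoMarked m := by
  ext w
  by_cases h : w = v
  · subst h
    have h1 : m w = 1 := by simpa [oneMarked] using hv
    simp [twoMarked, h1]
  · simp [twoMarked, h]

theorem markD_markD : (markD (V := V)) ∘ₗ markD = 0 := by
  refine Finsupp.lhom_ext' fun m => LinearMap.ext_ring ?_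
  simp only [LinearMap.comp_apply, Finsupp.lsingle_apply, markD_single, map_sum, map_smul,
    LinearMap.zero_apply, oneMarked_update]
  refine sum_sgn_eq_zero (oneMarked m)
    (fun v u => Finsupp.single (Function.update (Function.update m v 0) u 0) (1 : ℤ)) ?_
  intro v _ u _ huv
  simp only [Function.update_comm huv]

theorem markD_mem (G : SimpleGraph V) (j i : ℕ) (x : (V → Fin 3) →₀ ℤ)
    (hx : x ∈ T G (i + 1) j) : markD x ∈ T G i j := by
  have hle : T G (i + 1) j ≤ (T G i j).comap markD := by
    rw [T, Finsupp.supported_eq_span_single, Submodule.span_le]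
    rintro _ ⟨m, ⟨hm, hi, hj⟩, rfl⟩
    simp only [SetLike.mem_coe, Submodule.mem_comap]
    rw [markD_single]
    refine Submodule.sum_mem _ fun v hv => Submodule.smul_mem _ _ ?_
    refine Finsupp.single_mem_supported ℤ _ ⟨?_, ?_, ?_⟩
    · unfold IsMarking
      rw [marked_update]
      exact Set.Pairwise.mono (Finset.coe_subset.mpr (Finset.erase_subset v _)) hm
    · have hv' : v ∈ marked m := by
        have h1 : m v = 1 := by simpa [oneMarked] using hv
        simp [marked, h1]
      have := Finset.card_erase_add_one hv'
      rw [marked_update]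
      omega
    · rw [twoMarked_update m hv, hj]
  exact hle hx

/-- The differential `d : T_{i+1,j}(G) → T_{i,j}(G)`. -/
noncomputable def dT (G : SimpleGraph V) (j i : ℕ) : T G (i + 1) j →ₗ[ℤ] T G i j :=
  markD.restrict (markD_mem G j i)

/-- The chain complex `(T_{•,j}(G), d)`. -/
noncomputable def markingComplex (G : SimpleGraph V) (j : ℕ) : ChainComplex (ModuleCat ℤ) ℕ :=
  ChainComplex.of (fun i => ModuleCat.of ℤ (T G i j))
    (fun i => ModuleCat.ofHom (dT G j i))
    (fun i => by
      refine ModuleCat.hom_ext (LinearMap.ext fun x => Subtype.ext ?_)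
      exact LinearMap.congr_fun markD_markD (x : (V → Fin 3) →₀ ℤ))

/-- The entry `E¹_{p,q} = H_p(T_{•,q}(G), d)`. -/
noncomputable def E1 (G : SimpleGraph V) (p q : ℕ) : ModuleCat ℤ :=
  (markingComplex G q).homology p

end Markings

end IndepHomology

/-! The differential never touches a label 2, so the complex with `q` labels 2 splits over the
independent sets `U` with `q` elements. The summand at `U` is a shifted augmented chain complex of
Ind(G - N[U]), whence E¹_{p,q} = ⊕_U H̃_{p-q-1}(Ind(G - N[U])); `toSets` and `ofSets` express this
on chains.

For q = p only H̃_{-1} occurs. It is nonzero exactly when G - N[U] is empty, that is, when `U` is a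
maximal independent set. This gives the equivalence for every graph.

For q > 0, deleting N[U] from a path or cycle leaves a forest. The key lemma `isExactOn_of_leaves`
says that H̃_{d-1}(Ind H) ≠ 0 for a forest H forces a maximal independent set of H with `d`
elements; joined to `U`, it is one of G with q + d elements, so d = p - q is excluded. The lemma is
an induction along a leaf `v` with neighbor `w`: in H - w the vertex `v` is isolated, so Ind(H - w)
is a cone, and the homology of Ind(H) is that of Ind(H - N[w]) shifted by one. Correspondingly,
adding `w` to a maximal independent set of H - N[w] gives one of H. -/

namespace IndepHomology

/-! ### Cone and link operators on simplicial chains -/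

section Cone

variable {V : Type*} [LinearOrder V]

theorem sgn_mul_self (s : Finset V) (v : V) : sgn s v * sgn s v = 1 := by
  unfold sgn
  rw [← mul_pow]
  simp

theorem sgn_erase_same (s : Finset V) (v : V) : sgn (s.erase v) v = sgn s v := by
  unfold sgn
  congr 2
  ext w
  simp only [Finset.mem_filter, Finset.mem_erase]
  constructor
  · rintro ⟨⟨_, hs⟩, hw⟩
    exact ⟨hs, hw⟩
  · rintro ⟨hs, hw⟩
    exact ⟨⟨hw.ne, hs⟩, hw⟩

theorem sgn_insert_same (s : Finset V) {v : V} (hv : v ∉ s) : sgn (insert v s) v = sgn s v := by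
  rw [← sgn_erase_same (insert v s), Finset.erase_insert hv]

theorem sgn_mul_insert (s : Finset V) {u v : V} (hu : u ∈ s) (hv : v ∉ s) :
    sgn s v * sgn (insert v s) u = - (sgn s u * sgn (s.erase u) v) := by
  have hne : u ≠ v := fun h => hv (h ▸ hu)
  have h := sgn_swap (insert v s) (Finset.mem_insert_of_mem hu) (Finset.mem_insert_self v s) hne
  have hv' : v ∉ s.erase u := fun h' => hv (Finset.mem_of_mem_erase h')
  rw [Finset.erase_insert hv, sgn_insert_same s hv, Finset.erase_insert_of_ne hne.symm,
    sgn_insert_same _ hv'] at h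
  have h1 := sgn_mul_self s u
  have h2 := sgn_mul_self (insert v s) u
  -- Multiply the swap identity by the two signs of `u` and cancel their squares.
  linear_combination sgn s u * sgn (insert v s) u * h
    - sgn s v * sgn (insert v s) u * h1 - sgn s u * sgn (s.erase u) v * h2

/-- The cone operator with apex `v`: it adds `v` to the sets without `v` and kills the others. -/
noncomputable def cone (v : V) : (Finset V →₀ ℤ) →ₗ[ℤ] (Finset V →₀ ℤ) :=
  Finsupp.linearCombination ℤ fun s : Finset V =>
    if v ∈ s then 0 else sgn s v • Finsupp.single (insert v s) (1 : ℤ)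

theorem cone_single (v : V) (s : Finset V) :
    cone v (Finsupp.single s (1 : ℤ)) =
      if v ∈ s then 0 else sgn s v • Finsupp.single (insert v s) (1 : ℤ) := by
  simp [cone]

/-- The link operator at `v`: it removes `v` from the sets with `v` and kills the others. -/
noncomputable def link (v : V) : (Finset V →₀ ℤ) →ₗ[ℤ] (Finset V →₀ ℤ) :=
  Finsupp.linearCombination ℤ fun s : Finset V =>
    if v ∈ s then sgn s v • Finsupp.single (s.erase v) (1 : ℤ) else 0

theorem link_single (v : V) (s : Finset V) :
    link v (Finsupp.single s (1 : ℤ)) =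
      if v ∈ s then sgn s v • Finsupp.single (s.erase v) (1 : ℤ) else 0 := by
  simp [link]

/-- The cone operator is a contracting homotopy. -/
theorem boundary_cone (v : V) (x : Finset V →₀ ℤ) :
    boundary (cone v x) = x - cone v (boundary x) := by
  suffices h : boundary ∘ₗ cone v = LinearMap.id - cone v ∘ₗ boundary from
    LinearMap.congr_fun h x
  refine Finsupp.lhom_ext' fun s => LinearMap.ext_ring ?_
  simp only [LinearMap.comp_apply, Finsupp.lsingle_apply, LinearMap.sub_apply, LinearMap.id_apply,
    boundary_single, map_sum, map_smul, cone_single]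
  by_cases hv : v ∈ s
  · rw [if_pos hv, map_zero, Finset.sum_eq_single_of_mem v hv]
    · rw [if_neg (Finset.notMem_erase v s), sgn_erase_same, Finset.insert_erase hv, smul_smul,
        sgn_mul_self, one_smul, sub_self]
    · intro u _ huv
      rw [if_pos (Finset.mem_erase.2 ⟨huv.symm, hv⟩), smul_zero]
  · rw [if_neg hv, map_smul, boundary_single, Finset.sum_insert hv, Finset.erase_insert hv,
      sgn_insert_same s hv, smul_add, smul_smul, sgn_mul_self, one_smul, sub_eq_add_neg,
      Finset.smul_sum, ← Finset.sum_neg_distrib]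
    congr 1
    refine Finset.sum_congr rfl fun u hu => ?_
    have hne : v ≠ u := fun h => hv (h ▸ hu)
    rw [if_neg fun h' => hv (Finset.mem_of_mem_erase h'), smul_smul, smul_smul,
      sgn_mul_insert s hu hv, Finset.erase_insert_of_ne hne, neg_smul]

/-- Boundary terms that delete `v` die under the link; the others delete `v` and some `u` in both
orders, with opposite signs. Hence the link of a cycle is a cycle. -/
theorem link_boundary (v : V) (x : Finset V →₀ ℤ) :
    link v (boundary x) = - boundary (link v x) := by
  suffices h : link v ∘ₗ boundary = - (boundary ∘ₗ link v) from LinearMap.congr_fun h x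
  refine Finsupp.lhom_ext' fun s => LinearMap.ext_ring ?_
  simp only [LinearMap.comp_apply, Finsupp.lsingle_apply, LinearMap.neg_apply,
    boundary_single, map_sum, map_smul, link_single]
  by_cases hv : v ∈ s
  · rw [if_pos hv, ← Finset.add_sum_erase s _ hv, if_neg (Finset.notMem_erase v s), smul_zero,
      zero_add, map_smul, boundary_single, Finset.smul_sum, ← Finset.sum_neg_distrib]
    refine Finset.sum_congr rfl fun u hu => ?_
    obtain ⟨huv, hu⟩ := Finset.mem_erase.1 hu
    rw [if_pos (Finset.mem_erase.2 ⟨huv.symm, hv⟩), smul_smul, smul_smul,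
      sgn_swap s hv hu huv.symm, Finset.erase_right_comm, neg_smul]
  · rw [if_neg hv, map_zero, neg_zero]
    refine Finset.sum_eq_zero fun u _ => ?_
    rw [if_neg fun h' => hv (Finset.mem_of_mem_erase h'), smul_zero]

/-- On sets containing `v` the cone undoes the link, the two signs cancelling. -/
theorem filter_add_cone_link (v : V) (x : Finset V →₀ ℤ) :
    x.filter (fun s => v ∉ s) + cone v (link v x) = x := by
  induction x using Finsupp.induction_linear with
  | zero => rw [Finsupp.filter_zero, map_zero, map_zero, add_zero]
  | add x y hx hy =>
    rw [Finsupp.filter_add, map_add, map_add]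
    nth_rewrite 3 [← hx]
    nth_rewrite 3 [← hy]
    abel
  | single s a =>
    rw [← mul_one a, ← smul_eq_mul, ← Finsupp.smul_single, map_smul, map_smul, Finsupp.filter_smul,
      ← smul_add, link_single]
    congr 1
    by_cases hv : v ∈ s
    · rw [if_pos hv, map_smul, cone_single, if_neg (Finset.notMem_erase v s), sgn_erase_same,
        Finset.insert_erase hv, smul_smul, sgn_mul_self, one_smul,
        Finsupp.filter_single_of_neg _ (by simpa using hv), zero_add]
    · rw [if_neg hv, map_zero, add_zero, Finsupp.filter_single_of_pos (fun s : Finset V => v ∉ s) hv]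

end Cone

/-! ### Vanishing of homology for independence complexes of forests -/

section Exactness

variable {V : Type*} (G : SimpleGraph V)

/-- The chains on the independent sets of `G` with `d` elements that are contained in `S`. -/
def indepChains (S : Finset V) (d : ℕ) : Submodule ℤ (Finset V →₀ ℤ) :=
  Finsupp.supported ℤ ℤ {s : Finset V | G.IsIndepSet (s : Set V) ∧ s ⊆ S ∧ s.card = d}

variable {G}

theorem single_mem_indepChains {S s : Finset V} {d : ℕ} (hs : G.IsIndepSet (s : Set V))
    (hS : s ⊆ S) (hd : s.card = d) : Finsupp.single s (1 : ℤ) ∈ indepChains G S d :=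
  Finsupp.single_mem_supported ℤ _ ⟨hs, hS, hd⟩

theorem indepChains_le_comap {M : Type*} [AddCommGroup M] {S : Finset V} {d : ℕ}
    (f : (Finset V →₀ ℤ) →ₗ[ℤ] M) (P : Submodule ℤ M)
    (h : ∀ s : Finset V, G.IsIndepSet (s : Set V) → s ⊆ S → s.card = d →
      f (Finsupp.single s 1) ∈ P) {x : Finset V →₀ ℤ} (hx : x ∈ indepChains G S d) : f x ∈ P := by
  have hle : indepChains G S d ≤ P.comap f := by
    rw [indepChains, Finsupp.supported_eq_span_single, Submodule.span_le]
    rintro _ ⟨s, ⟨h1, h2, h3⟩, rfl⟩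
    exact h s h1 h2 h3
  exact hle hx

theorem indepChains_mono {S S' : Finset V} (h : S ⊆ S') (d : ℕ) :
    indepChains G S d ≤ indepChains G S' d :=
  Finsupp.supported_mono fun _ hs => ⟨hs.1, hs.2.1.trans h, hs.2.2⟩

variable [LinearOrder V]

variable (G) in
/-- The reduced homology of the complex of the independent sets of `G` contained in `S` vanishes
at the sets with `d` elements. -/
def IsExactOn (S : Finset V) (d : ℕ) : Prop :=
  ∀ x ∈ indepChains G S d, boundary x = 0 → ∃ y ∈ indepChains G S (d + 1), boundary y = x

theorem cone_mem {S S' : Finset V} {v : V} {d : ℕ} (hS : S' ⊆ S) (hv : v ∈ S)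
    (hadj : ∀ u ∈ S', ¬ G.Adj v u) {x : Finset V →₀ ℤ} (hx : x ∈ indepChains G S' d) :
    cone v x ∈ indepChains G S (d + 1) := by
  refine indepChains_le_comap _ _ (fun s hs hsS hd => ?_) hx
  rw [cone_single]
  split_ifs with h
  · exact Submodule.zero_mem _
  · refine Submodule.smul_mem _ _ (single_mem_indepChains ?_ ?_ ?_)
    · rw [Finset.coe_insert]
      exact hs.insert fun u hu _ => ⟨hadj u (hsS hu), fun h => hadj u (hsS hu) h.symm⟩
    · exact Finset.insert_subset hv (hsS.trans hS)
    · rw [Finset.card_insert_of_notMem h, hd]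

open Classical in
theorem link_mem {S : Finset V} {v : V} {d : ℕ} {x : Finset V →₀ ℤ}
    (hx : x ∈ indepChains G S (d + 1)) :
    link v x ∈ indepChains G (S.filter fun u => u ≠ v ∧ ¬ G.Adj v u) d := by
  refine indepChains_le_comap _ _ (fun s hs hsS hd => ?_) hx
  rw [link_single]
  split_ifs with h
  · refine Submodule.smul_mem _ _ (single_mem_indepChains ?_ ?_ ?_)
    · exact Set.Pairwise.mono (Finset.coe_subset.mpr (Finset.erase_subset v s)) hs
    · intro u hu
      obtain ⟨huv, hu⟩ := Finset.mem_erase.1 hu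
      exact Finset.mem_filter.2 ⟨hsS hu, huv, hs h hu huv.symm⟩
    · rw [Finset.card_erase_of_mem h, hd, Nat.add_sub_cancel]
  · exact Submodule.zero_mem _

theorem filter_mem {S : Finset V} {v : V} {d : ℕ} {x : Finset V →₀ ℤ}
    (hx : x ∈ indepChains G S d) :
    x.filter (fun s => v ∉ s) ∈ indepChains G (S.erase v) d := by
  rw [indepChains, Finsupp.mem_supported] at hx ⊢
  intro s hs
  simp only [Finset.mem_coe, Finsupp.support_filter, Finset.mem_filter] at hs
  obtain ⟨h1, h2, h3⟩ := hx hs.1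
  exact ⟨h1, Finset.subset_erase.2 ⟨h2, hs.2⟩, h3⟩

/-- The cone over a cycle bounds it. The apex has to avoid only the neighbors of the smaller set
`S'` carrying the cycle, so it may have neighbors in `S`. -/
theorem isExactOn_of_isolated {S S' : Finset V} {v : V} {d : ℕ} (hS : S' ⊆ S) (hv : v ∈ S)
    (hadj : ∀ u ∈ S', ¬ G.Adj v u) {x : Finset V →₀ ℤ} (hx : x ∈ indepChains G S' d)
    (hd : boundary x = 0) : ∃ y ∈ indepChains G S (d + 1), boundary y = x :=
  ⟨cone v x, cone_mem hS hv hadj hx, by rw [boundary_cone, hd, map_zero, sub_zero]⟩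

theorem isExactOn_zero {S : Finset V} (hS : S.Nonempty) : IsExactOn G S 0 := by
  obtain ⟨v, hv⟩ := hS
  intro x hx hd
  -- A chain on the empty face lives on `∅`, so any vertex of `S` can serve as apex.
  refine isExactOn_of_isolated (S' := ∅) (Finset.empty_subset S) hv (by simp) ?_ hd
  refine Finsupp.supported_mono ?_ hx
  rintro s ⟨h1, _, h3⟩
  exact ⟨h1, (Finset.card_eq_zero.1 h3).le, h3⟩

/-- If every nonempty subset of `S` has a vertex with at most one neighbor in that subset, then
reduced homology is nonzero only in the degrees of maximal independent subsets of `S`. -/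
theorem isExactOn_of_leaves (S : Finset V) (d : ℕ)
    (hS : ∀ T ⊆ S, T.Nonempty → ∃ v ∈ T, ∀ u ∈ T, ∀ u' ∈ T, G.Adj v u → G.Adj v u' → u = u')
    (hI : ¬ ∃ I ⊆ S, G.IsIndepSet (I : Set V) ∧ I.card = d ∧
      ∀ v ∈ S, v ∉ I → ∃ u ∈ I, G.Adj u v) : IsExactOn G S d := by
  classical
  induction S using Finset.strongInduction generalizing d with
  | H S ih =>
  rcases S.eq_empty_or_nonempty with rfl | hne
  -- For `d = 0` the empty set is itself a maximal independent subset, against `hI`; for `d > 0`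
  -- there are no nonzero chains.
  · cases d with
    | zero => exact (hI ⟨∅, by simp⟩).elim
    | succ d =>
      intro x hx _
      refine ⟨0, Submodule.zero_mem _, ?_⟩
      rw [map_zero]
      have : x ∈ (⊥ : Submodule ℤ (Finset V →₀ ℤ)) := by
        refine indepChains_le_comap LinearMap.id ⊥ (fun s _ h2 h3 => ?_) hx
        rw [Finset.subset_empty.1 h2] at h3
        simp at h3
      exact ((Submodule.mem_bot ℤ).1 this).symm
  cases d with
  | zero => exact isExactOn_zero hne
  | succ d =>
  obtain ⟨v, hv, hleaf⟩ := hS S subset_rfl hne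
  intro x hx hd
  by_cases hw : ∃ w ∈ S, G.Adj v w
  swap
  · push Not at hw
    exact isExactOn_of_isolated subset_rfl hv hw hx hd
  obtain ⟨w, hw, hvw⟩ := hw
  -- This is H - N[w]; a maximal independent subset of it with `d` elements becomes one of `S` with
  -- `d + 1` elements on adding `w`.
  set S' := S.filter fun u => u ≠ w ∧ ¬ G.Adj w u with hS'
  have hsub : S' ⊆ S := Finset.filter_subset _ _
  have hexact : IsExactOn G S' d := by
    refine ih S' ?_ d (fun T hT => hS T (hT.trans hsub)) ?_
    · exact Finset.filter_ssubset.2 ⟨w, hw, by simp⟩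
    · rintro ⟨I, hIS, hI1, hI2, hI3⟩
      have hmem : ∀ u ∈ I, u ≠ w ∧ ¬ G.Adj w u := fun u hu => (Finset.mem_filter.1 (hIS hu)).2
      refine hI ⟨insert w I, Finset.insert_subset hw (hIS.trans hsub), ?_, ?_, ?_⟩
      · rw [Finset.coe_insert]
        exact hI1.insert fun u hu _ =>
          ⟨(hmem u hu).2, fun h => (hmem u hu).2 h.symm⟩
      · rw [Finset.card_insert_of_notMem fun h => (hmem w h).1 rfl, hI2]
      · intro u hu huI
        rw [Finset.mem_insert, not_or] at huI
        by_cases h : G.Adj w u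
        · exact ⟨w, Finset.mem_insert_self w I, h⟩
        · obtain ⟨z, hz, hzu⟩ := hI3 u (Finset.mem_filter.2 ⟨hu, huI.1, h⟩) huI.2
          exact ⟨z, Finset.mem_insert_of_mem hz, hzu⟩
  obtain ⟨c, hc, hcx⟩ := hexact (link w x) (link_mem hx)
    (by rw [← neg_eq_zero, ← link_boundary, hd, map_zero])
  have hcone : cone w c ∈ indepChains G S (d + 1 + 1) :=
    cone_mem hsub hw (fun u hu => (Finset.mem_filter.1 hu).2.2) hc
  -- Adding this boundary replaces the part of `x` through `w`, the cone over its link, by the chain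
  -- `c` in H - N[w].
  have hz : x + boundary (cone w c) = x.filter (fun s => w ∉ s) + c := by
    rw [boundary_cone, hcx]
    nth_rewrite 1 [← filter_add_cone_link w x]
    abel
  have hzmem : x + boundary (cone w c) ∈ indepChains G (S.erase w) (d + 1) := by
    rw [hz]
    refine Submodule.add_mem _ (filter_mem hx) (indepChains_mono ?_ _ hc)
    intro u hu
    obtain ⟨h1, h2, _⟩ := Finset.mem_filter.1 hu
    exact Finset.mem_erase.2 ⟨h2, h1⟩
  -- The corrected cycle avoids `w`, the only neighbor of `v`, so the cone with apex `v` bounds it.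
  obtain ⟨y, hy, hyx⟩ := isExactOn_of_isolated (Finset.erase_subset w S) hv (fun u hu h =>
      (Finset.mem_erase.1 hu).1 (hleaf u (Finset.mem_erase.1 hu).2 w hw h hvw)) hzmem (by
    rw [map_add, hd, zero_add]
    exact LinearMap.congr_fun boundary_boundary _)
  exact ⟨y - cone w c, Submodule.sub_mem _ hy hcone, by rw [map_sub, hyx, add_sub_cancel_right]⟩

end Exactness

/-! ### Vanishing of homology as exactness on chains -/

section HomologyVanishing

theorem augChainComplex_d {W : Type*} [LinearOrder W] (K : AbstractSimplicialComplex W) (n : ℤ) :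
    (augChainComplex K).d (n + 1) n = ModuleCat.ofHom (augBoundary K n) :=
  ChainComplex.of_d (fun n => ModuleCat.of ℤ (augChains K n))
    (fun n => ModuleCat.ofHom (augBoundary K n)) n

theorem markingComplex_d {V : Type*} [Fintype V] [LinearOrder V] (G : SimpleGraph V) (q i : ℕ) :
    (markingComplex G q).d (i + 1) i = ModuleCat.ofHom (dT G q i) :=
  ChainComplex.of_d (fun i => ModuleCat.of ℤ (T G i q)) (fun i => ModuleCat.ofHom (dT G q i)) i

theorem isZero_reducedHomology {W : Type*} [Fintype W] [LinearOrder W] (H : SimpleGraph W) (n : ℤ)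
    (h : ∀ d : ℕ, (d : ℤ) = n + 1 → IsExactOn H Finset.univ d) :
    Limits.IsZero (reducedHomology (indComplex H) n) := by
  obtain ⟨m, rfl⟩ : ∃ m, n = m + 1 := ⟨n - 1, by ring⟩
  have hmem : ∀ (d : ℕ) (k : ℤ), (d : ℤ) = k + 1 →
      augChains (indComplex H) k = indepChains H Finset.univ d := by
    intro d k hk
    unfold augChains indepChains
    congr 1
    ext s
    have hf : (s = ∅ ∨ s ∈ (indComplex H).faces) ↔ H.IsIndepSet (s : Set W) := by
      constructor
      · rintro (rfl | hs)
        · simp [SimpleGraph.IsIndepSet]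
        · exact hs.2
      · exact fun hs => s.eq_empty_or_nonempty.imp id fun hne => ⟨hne, hs⟩
    change (s = ∅ ∨ s ∈ (indComplex H).faces) ∧ (s.card : ℤ) = k + 1 ↔
      H.IsIndepSet (s : Set W) ∧ s ⊆ Finset.univ ∧ s.card = d
    rw [hf, and_iff_right (Finset.subset_univ s)]
    refine and_congr_right fun _ => ?_
    omega
  refine HomologicalComplex.ExactAt.isZero_homology ?_
  rw [HomologicalComplex.exactAt_iff' _ (m + 1 + 1) (m + 1) m (by simp) (by simp),
    ShortComplex.moduleCat_exact_iff]
  intro x hx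
  have hx' : augBoundary (indComplex H) m x = 0 := by
    have h0 : ModuleCat.Hom.hom ((augChainComplex (indComplex H)).d (m + 1) m) x = 0 := hx
    rw [augChainComplex_d] at h0
    exact h0
  have hx0 : boundary x.1 = 0 := congrArg Subtype.val hx'
  suffices hy : ∃ y ∈ augChains (indComplex H) (m + 1 + 1), boundary y = x.1 by
    obtain ⟨y, hy, hyx⟩ := hy
    refine ⟨(⟨y, hy⟩ : augChains (indComplex H) (m + 1 + 1)), ?_⟩
    change ModuleCat.Hom.hom ((augChainComplex (indComplex H)).d (m + 1 + 1) (m + 1)) _ = x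
    rw [augChainComplex_d]
    exact Subtype.ext hyx
  -- Faces in degree `m + 1` have `m + 1 + 1` vertices; if this is negative there are none and the
  -- chain group is zero.
  rcases lt_or_ge (m + 1 + 1) 0 with hneg | hpos
  · refine ⟨0, Submodule.zero_mem _, ?_⟩
    have hxm : x.1 ∈ Finsupp.supported ℤ ℤ (∅ : Set (Finset W)) := by
      refine Finsupp.supported_mono ?_ x.2
      rintro s ⟨_, hs⟩
      omega
    rw [Finsupp.supported_empty, Submodule.mem_bot] at hxm
    rw [map_zero, hxm]
  · obtain ⟨d, hd⟩ := Int.eq_ofNat_of_zero_le hpos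
    have hxm : x.1 ∈ indepChains H Finset.univ d := hmem d (m + 1) hd.symm ▸ x.2
    obtain ⟨y, hy, hyx⟩ := h d hd.symm x.1 hxm hx0
    exact ⟨y, (hmem (d + 1) (m + 1 + 1) (by push_cast; omega)).symm ▸ hy, hyx⟩

variable {V : Type*} [Fintype V] [LinearOrder V]

theorem markD_eq_zero (G : SimpleGraph V) (q : ℕ) {x : (V → Fin 3) →₀ ℤ} (hx : x ∈ T G 0 q) :
    markD x = 0 := by
  have hle : T G 0 q ≤ LinearMap.ker (markD (V := V)) := by
    rw [T, Finsupp.supported_eq_span_single, Submodule.span_le]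
    rintro _ ⟨m, ⟨_, hi, _⟩, rfl⟩
    rw [SetLike.mem_coe, LinearMap.mem_ker, markD_single]
    refine Finset.sum_eq_zero fun v hv => ?_
    have hv' : v ∈ marked m := by
      have h1 : m v = 1 := by simpa [oneMarked] using hv
      simp [marked, h1]
    simp [Finset.card_eq_zero.1 hi] at hv'
  exact hle hx

theorem isZero_E1_iff (G : SimpleGraph V) (p q : ℕ) :
    Limits.IsZero (E1 G p q) ↔
      ∀ x ∈ T G p q, markD x = 0 → ∃ y ∈ T G (p + 1) q, markD y = x := by
  -- For `p = 0` the truncated `p - 1` is `0`, so the outgoing map is `d 0 0 = 0`. This agrees with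
  -- `markD`, which vanishes when nothing is marked.
  have hd0 : (markingComplex G q).d 0 0 = 0 := (markingComplex G q).shape 0 0 (by simp)
  have hker : ∀ x : T G p q, ModuleCat.Hom.hom ((markingComplex G q).d p (p - 1)) x = 0 ↔
      markD x.1 = 0 := by
    intro x
    cases p with
    | zero =>
      refine ⟨fun _ => markD_eq_zero G q x.2, fun _ => ?_⟩
      change ModuleCat.Hom.hom ((markingComplex G q).d 0 0) x = 0
      rw [hd0]
      rfl
    | succ p =>
      change ModuleCat.Hom.hom ((markingComplex G q).d (p + 1) p) x = 0 ↔ _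
      rw [markingComplex_d]
      exact ⟨fun h => congrArg Subtype.val h, fun h => Subtype.ext h⟩
  unfold E1
  rw [← HomologicalComplex.exactAt_iff_isZero_homology,
    HomologicalComplex.exactAt_iff' _ (p + 1) p (p - 1) (by simp) (by cases p <;> simp),
    ShortComplex.moduleCat_exact_iff]
  constructor
  · intro h x hx hdx
    obtain ⟨y, hy⟩ := h (⟨x, hx⟩ : T G p q) ((hker ⟨x, hx⟩).2 hdx)
    have hy' : ModuleCat.Hom.hom ((markingComplex G q).d (p + 1) p) y = (⟨x, hx⟩ : T G p q) := hy
    rw [markingComplex_d] at hy'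
    exact ⟨(show T G (p + 1) q from y).1, (show T G (p + 1) q from y).2, congrArg Subtype.val hy'⟩
  · intro h x hdx
    obtain ⟨y, hy, hyx⟩ := h (show T G p q from x).1 (show T G p q from x).2 ((hker x).1 hdx)
    refine ⟨(⟨y, hy⟩ : T G (p + 1) q), ?_⟩
    change ModuleCat.Hom.hom ((markingComplex G q).d (p + 1) p) _ = x
    rw [markingComplex_d]
    exact Subtype.ext hyx

end HomologyVanishing

/-! ### Splitting the marking complex by the set of labels 2 -/

section Splitting

variable {V : Type*}

theorem mem_closedNbhd {G : SimpleGraph V} {U : Set V} {v : V} :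
    v ∈ closedNbhd G U ↔ ∃ u ∈ U, v = u ∨ G.Adj u v := by
  simp [closedNbhd]

section

variable [Fintype V]

theorem disjoint_twoMarked_oneMarked (m : V → Fin 3) : Disjoint (twoMarked m) (oneMarked m) := by
  rw [Finset.disjoint_left]
  intro v h2 h1
  simp only [twoMarked, oneMarked, Finset.mem_filter, Finset.mem_univ, true_and] at h1 h2
  simp [h1] at h2

open Classical in
/-- The vertices of `G - N[U]`. -/
noncomputable def freeVertices (G : SimpleGraph V) (U : Finset V) : Finset V :=
  Finset.univ.filter fun v => v ∉ closedNbhd G (U : Set V)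

theorem mem_freeVertices {G : SimpleGraph V} {U : Finset V} {v : V} :
    v ∈ freeVertices G U ↔ ∀ u ∈ U, v ≠ u ∧ ¬ G.Adj u v := by
  simp [freeVertices, mem_closedNbhd, not_or]

theorem disjoint_of_subset_freeVertices {G : SimpleGraph V} {U s : Finset V} (h : s ⊆ freeVertices G U) :
    Disjoint U s :=
  Finset.disjoint_left.2 fun v hU hs => (mem_freeVertices.1 (h hs) v hU).1 rfl

end

variable [LinearOrder V]

/-- The marking with label `2` on `U` and label `1` on the rest of `s`. -/
def mark (U s : Finset V) : V → Fin 3 := fun v => if v ∈ U then 2 else if v ∈ s then 1 else 0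

theorem update_mark {U s : Finset V} (h : Disjoint U s) {v : V} (hv : v ∈ s) :
    Function.update (mark U s) v 0 = mark U (s.erase v) := by
  have hvU : v ∉ U := Finset.disjoint_right.1 h hv
  funext w
  by_cases hw : w = v
  · subst hw
    simp [mark, hvU]
  · simp [mark, hw]

/-- The chain of markings with label `2` exactly on `U` obtained from a chain of sets. -/
noncomputable def ofSets (U : Finset V) : (Finset V →₀ ℤ) →ₗ[ℤ] ((V → Fin 3) →₀ ℤ) :=
  Finsupp.linearCombination ℤ fun s : Finset V => Finsupp.single (mark U s) (1 : ℤ)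

theorem ofSets_single (U s : Finset V) :
    ofSets U (Finsupp.single s (1 : ℤ)) = Finsupp.single (mark U s) 1 := by
  simp [ofSets]

variable [Fintype V]

theorem oneMarked_mark {U s : Finset V} (h : Disjoint U s) : oneMarked (mark U s) = s := by
  ext v
  have : v ∈ U → v ∉ s := fun hU => Finset.disjoint_left.1 h hU
  simp only [oneMarked, Finset.mem_filter, Finset.mem_univ, true_and]
  unfold mark
  split_ifs <;> simp_all

theorem twoMarked_mark (U s : Finset V) : twoMarked (mark U s) = U := by
  ext v
  simp only [twoMarked, Finset.mem_filter, Finset.mem_univ, true_and]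
  unfold mark
  split_ifs <;> simp_all

theorem marked_mark (U s : Finset V) : marked (mark U s) = U ∪ s := by
  ext v
  simp only [marked, Finset.mem_filter, Finset.mem_univ, true_and, Finset.mem_union]
  unfold mark
  split_ifs <;> simp_all

theorem mark_twoMarked_oneMarked (m : V → Fin 3) : mark (twoMarked m) (oneMarked m) = m := by
  funext v
  simp only [mark, oneMarked, twoMarked, Finset.mem_filter, Finset.mem_univ, true_and]
  generalize m v = a
  fin_cases a <;> rfl

theorem marked_eq_union (m : V → Fin 3) : marked m = twoMarked m ∪ oneMarked m := by
  rw [← marked_mark, mark_twoMarked_oneMarked]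

/-- The component of a chain of markings at the markings with label `2` exactly on `U`. -/
noncomputable def toSets (U : Finset V) : ((V → Fin 3) →₀ ℤ) →ₗ[ℤ] (Finset V →₀ ℤ) :=
  Finsupp.linearCombination ℤ fun m : V → Fin 3 =>
    if twoMarked m = U then Finsupp.single (oneMarked m) (1 : ℤ) else 0

theorem toSets_single (U : Finset V) (m : V → Fin 3) :
    toSets U (Finsupp.single m (1 : ℤ)) =
      if twoMarked m = U then Finsupp.single (oneMarked m) 1 else 0 := by
  simp [toSets]

theorem sum_ofSets_toSets (x : (V → Fin 3) →₀ ℤ) : ∑ U, ofSets U (toSets U x) = x := by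
  suffices h : ∑ U : Finset V, ofSets U ∘ₗ toSets U = LinearMap.id by
    simpa using LinearMap.congr_fun h x
  refine Finsupp.lhom_ext' fun m => LinearMap.ext_ring ?_
  simp only [LinearMap.comp_apply, LinearMap.sum_apply, Finsupp.lsingle_apply, toSets_single,
    LinearMap.id_apply]
  rw [Finset.sum_eq_single_of_mem (twoMarked m) (Finset.mem_univ _)]
  · rw [if_pos rfl, ofSets_single, mark_twoMarked_oneMarked]
  · intro U _ hU
    rw [if_neg hU.symm, map_zero]

/-- The differential fixes the set of labels 2, so each component is a chain map, with the same
signs because both count only labels 1. -/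
theorem boundary_toSets (U : Finset V) (x : (V → Fin 3) →₀ ℤ) :
    boundary (toSets U x) = toSets U (markD x) := by
  suffices h : boundary ∘ₗ toSets U = toSets U ∘ₗ markD from LinearMap.congr_fun h x
  refine Finsupp.lhom_ext' fun m => LinearMap.ext_ring ?_
  simp only [LinearMap.comp_apply, Finsupp.lsingle_apply, toSets_single, markD_single, map_sum,
    map_smul]
  split_ifs with h
  · rw [boundary_single]
    refine Finset.sum_congr rfl fun v hv => ?_
    rw [twoMarked_update m hv, if_pos h, oneMarked_update]
  · rw [map_zero]
    refine (Finset.sum_eq_zero fun v hv => ?_).symm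
    rw [twoMarked_update m hv, if_neg h, smul_zero]

variable {G : SimpleGraph V}

theorem isIndepSet_union {U s : Finset V} (hU : G.IsIndepSet (U : Set V))
    (hs : G.IsIndepSet (s : Set V)) (h : s ⊆ freeVertices G U) :
    G.IsIndepSet ((U ∪ s : Finset V) : Set V) := by
  rw [Finset.coe_union]
  refine Set.pairwise_union.2 ⟨hU, hs, fun a ha b hb _ => ?_⟩
  have hab := (mem_freeVertices.1 (h hb) a ha).2
  exact ⟨hab, fun h => hab h.symm⟩

/-- The support in `freeVertices G U` matters: `mark` lets label 2 win, so `s` is recovered as the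
set of labels 1 only if it is disjoint from `U`. -/
theorem markD_ofSets {U : Finset V} {d : ℕ} {x : Finset V →₀ ℤ}
    (hx : x ∈ indepChains G (freeVertices G U) d) :
    markD (ofSets U x) = ofSets U (boundary x) := by
  rw [← sub_eq_zero]
  refine (Submodule.mem_bot ℤ).1
    (indepChains_le_comap (markD ∘ₗ ofSets U - ofSets U ∘ₗ boundary) ⊥ (fun s _ hs _ => ?_) hx)
  have hdisj := disjoint_of_subset_freeVertices hs
  rw [Submodule.mem_bot, LinearMap.sub_apply, LinearMap.comp_apply, LinearMap.comp_apply,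
    ofSets_single, markD_single, boundary_single, map_sum, oneMarked_mark hdisj, sub_eq_zero]
  refine Finset.sum_congr rfl fun v hv => ?_
  rw [map_smul, ofSets_single, update_mark hdisj hv]

theorem ofSets_mem {U : Finset V} (hU : G.IsIndepSet (U : Set V)) {d : ℕ} {x : Finset V →₀ ℤ}
    (hx : x ∈ indepChains G (freeVertices G U) d) : ofSets U x ∈ T G (d + U.card) U.card := by
  refine indepChains_le_comap _ _ (fun s hs hsU hd => ?_) hx
  rw [ofSets_single]
  refine Finsupp.single_mem_supported ℤ _ ⟨?_, ?_, ?_⟩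
  · unfold IsMarking
    rw [marked_mark]
    exact isIndepSet_union hU hs hsU
  · rw [marked_mark, Finset.card_union_of_disjoint (disjoint_of_subset_freeVertices hsU), hd,
      add_comm]
  · rw [twoMarked_mark]

/-- The component at `U` can be nonzero only if some marking in this bidegree has `U` as its set of
labels 2; such a marking makes `U` independent and gives `q ≤ p`, so the truncated `p - q` is a true
difference. -/
theorem toSets_mem {p q : ℕ} {x : (V → Fin 3) →₀ ℤ} (hx : x ∈ T G p q) (U : Finset V) :
    toSets U x = 0 ∨ G.IsIndepSet (U : Set V) ∧ U.card = q ∧ q ≤ p ∧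
      toSets U x ∈ indepChains G (freeVertices G U) (p - q) := by
  have hspan : ∀ P : Submodule ℤ (Finset V →₀ ℤ),
      (∀ m, IsMarking G m → (marked m).card = p → (twoMarked m).card = q → twoMarked m = U →
        Finsupp.single (oneMarked m) 1 ∈ P) → toSets U x ∈ P := by
    intro P hP
    have hle : T G p q ≤ P.comap (toSets U) := by
      rw [T, Finsupp.supported_eq_span_single, Submodule.span_le]
      rintro _ ⟨m, ⟨h1, h2, h3⟩, rfl⟩
      rw [SetLike.mem_coe, Submodule.mem_comap, toSets_single]
      split_ifs with h
      · exact hP m h1 h2 h3 h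
      · exact Submodule.zero_mem _
    exact hle hx
  by_cases hex : ∃ m, IsMarking G m ∧ (marked m).card = p ∧ (twoMarked m).card = q ∧
      twoMarked m = U
  swap
  · refine Or.inl ((Submodule.mem_bot ℤ).1 (hspan ⊥ fun m h1 h2 h3 h4 => ?_))
    exact (hex ⟨m, h1, h2, h3, h4⟩).elim
  right
  have key : ∀ m, IsMarking G m → (marked m).card = p → (twoMarked m).card = q →
      (G.IsIndepSet (twoMarked m : Set V) ∧ G.IsIndepSet (oneMarked m : Set V)) ∧
      q + (oneMarked m).card = p ∧ oneMarked m ⊆ freeVertices G (twoMarked m) := by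
    intro m h1 h2 h3
    unfold IsMarking at h1
    rw [marked_eq_union] at h1 h2
    have hdisj := disjoint_twoMarked_oneMarked m
    rw [Finset.card_union_of_disjoint hdisj, h3] at h2
    rw [Finset.coe_union] at h1
    refine ⟨⟨h1.mono Set.subset_union_left, h1.mono Set.subset_union_right⟩, h2, ?_⟩
    intro v hv
    refine mem_freeVertices.2 fun u hu => ?_
    have hne : v ≠ u := fun h => Finset.disjoint_left.1 hdisj hu (h ▸ hv)
    exact ⟨hne, h1 (Or.inl hu) (Or.inr hv) hne.symm⟩
  obtain ⟨m, h1, h2, h3, rfl⟩ := hex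
  obtain ⟨⟨k1, _⟩, k2, _⟩ := key m h1 h2 h3
  refine ⟨k1, h3, by omega, hspan _ fun m' h1' h2' h3' h4' => ?_⟩
  obtain ⟨⟨_, k1'⟩, k2', k3'⟩ := key m' h1' h2' h3'
  exact single_mem_indepChains k1' (h4' ▸ k3') (by omega)

theorem isZero_E1_of_isExactOn {p q : ℕ}
    (h : ∀ U : Finset V, G.IsIndepSet (U : Set V) → U.card = q → q ≤ p →
      IsExactOn G (freeVertices G U) (p - q)) : Limits.IsZero (E1 G p q) := by
  rw [isZero_E1_iff]
  intro x hx hdx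
  -- Each component is a cycle and is bounded separately; the bounding chains are then summed.
  have hU : ∀ U : Finset V, ∃ y ∈ T G (p + 1) q, markD y = ofSets U (toSets U x) := by
    intro U
    rcases toSets_mem hx U with h0 | ⟨h1, h2, h3, h4⟩
    · exact ⟨0, Submodule.zero_mem _, by rw [h0, map_zero, map_zero]⟩
    · obtain ⟨y, hy, hyx⟩ := h U h1 h2 h3 _ h4 (by rw [boundary_toSets, hdx, map_zero])
      refine ⟨ofSets U y, ?_, by rw [markD_ofSets hy, hyx]⟩
      have := ofSets_mem h1 hy
      rwa [h2, show p - q + 1 + q = p + 1 by omega] at this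
  choose y hy hyx using hU
  refine ⟨∑ U, y U, Submodule.sum_mem _ fun U _ => hy U, ?_⟩
  rw [map_sum, Finset.sum_congr rfl fun U _ => hyx U, sum_ofSets_toSets]

theorem freeVertices_eq_empty_of_maximal {I : Finset V} (hI : IsMaximalIndepSet G I) :
    freeVertices G I = ∅ := by
  rw [Finset.eq_empty_iff_forall_notMem]
  intro v hv
  have hs := isIndepSet_union (s := {v}) hI.1 (by simp [SimpleGraph.IsIndepSet])
    (Finset.singleton_subset_iff.2 hv)
  have hvI := hI.2 hs Finset.subset_union_left
    (Finset.mem_union_right _ (Finset.mem_singleton_self v))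
  exact (mem_freeVertices.1 hv v hvI).1 rfl

theorem isMaximalIndepSet_union {U I : Finset V} (hU : G.IsIndepSet (U : Set V))
    (hI : G.IsIndepSet (I : Set V)) (hIU : I ⊆ freeVertices G U)
    (hdom : ∀ v ∈ freeVertices G U, v ∉ I → ∃ u ∈ I, G.Adj u v) :
    IsMaximalIndepSet G (U ∪ I) := by
  refine ⟨isIndepSet_union hU hI hIU, fun J hJ hle v hv => ?_⟩
  by_contra hvn
  rw [Finset.mem_union, not_or] at hvn
  have hadj : ∀ u ∈ U ∪ I, ¬ G.Adj u v := fun u hu => hJ (hle hu) hv fun h => by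
    subst h
    exact (Finset.mem_union.1 hu).elim hvn.1 hvn.2
  have hfree : v ∈ freeVertices G U := mem_freeVertices.2 fun u hu =>
    ⟨fun h => hvn.1 (h ▸ hu), hadj u (Finset.mem_union_left _ hu)⟩
  obtain ⟨u, hu, huv⟩ := hdom v hfree hvn.2
  exact hadj u (Finset.mem_union_right _ hu) huv

/-- The marking with label 2 on `I` and 0 elsewhere is a cycle. To bound it, a marking would need
one more marked vertex outside N[I], and there is none. -/
theorem not_isZero_E1_of_maximal {I : Finset V} (hI : IsMaximalIndepSet G I) :
    ¬ Limits.IsZero (E1 G I.card I.card) := by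
  rw [isZero_E1_iff]
  intro h
  have hs : Finsupp.single (∅ : Finset V) (1 : ℤ) ∈ indepChains G (freeVertices G I) 0 :=
    single_mem_indepChains (by simp [SimpleGraph.IsIndepSet]) (Finset.empty_subset _) rfl
  have hb : boundary (Finsupp.single (∅ : Finset V) (1 : ℤ)) = 0 := by simp [boundary_single]
  have hx := ofSets_mem hI.1 hs
  rw [zero_add] at hx
  obtain ⟨y, hy, hyx⟩ := h _ hx (by rw [markD_ofSets hs, hb, map_zero])
  have h1 : boundary (toSets I y) = Finsupp.single ∅ 1 := by
    rw [boundary_toSets, hyx, ofSets_single, toSets_single, if_pos (twoMarked_mark I ∅),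
      oneMarked_mark (Finset.disjoint_empty_right I)]
  have h0 : toSets I y = 0 := by
    rcases toSets_mem hy I with h0 | ⟨_, _, _, hmem⟩
    · exact h0
    · refine (Submodule.mem_bot ℤ).1
        (indepChains_le_comap LinearMap.id ⊥ (fun s _ hs hd => ?_) hmem)
      rw [freeVertices_eq_empty_of_maximal hI, Finset.subset_empty] at hs
      rw [hs, Finset.card_empty] at hd
      omega
  rw [h0, map_zero] at h1
  exact one_ne_zero (Finsupp.single_eq_zero.1 h1.symm)

theorem freeVertices_nonempty {U : Finset V} (hU : G.IsIndepSet (U : Set V))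
    (hmax : ¬ IsMaximalIndepSet G U) : (freeVertices G U).Nonempty := by
  rw [Finset.nonempty_iff_ne_empty]
  intro h
  refine hmax ?_
  -- If no vertex is free, the empty set dominates the free vertices vacuously, so `U` alone is
  -- maximal.
  have := isMaximalIndepSet_union (I := ∅) hU (by simp [SimpleGraph.IsIndepSet])
    (Finset.empty_subset _) (by simp [h])
  rwa [Finset.union_empty] at this

end Splitting

/-! ### Leaves in subsets of paths and cycles -/

section PathsAndCycles

variable {V : Type*} {G : SimpleGraph V}

theorem exists_leaf_of_isPathGraph (hG : IsPathGraph G) (T : Finset V) (hT : T.Nonempty) :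
    ∃ v ∈ T, ∀ u ∈ T, ∀ u' ∈ T, G.Adj v u → G.Adj v u' → u = u' := by
  obtain ⟨n, _, ⟨e⟩⟩ := hG
  -- The last vertex of `T` along the path can have only its predecessor as a neighbor in `T`.
  obtain ⟨v, hv, hmax⟩ := T.exists_max_image (fun v => e v) hT
  refine ⟨v, hv, fun u hu u' hu' h h' => e.injective (Fin.ext ?_)⟩
  have h1 := Fin.le_def.1 (hmax u hu)
  have h2 := Fin.le_def.1 (hmax u' hu')
  rw [← e.map_adj_iff, SimpleGraph.pathGraph_adj] at h h'
  omega

theorem exists_leaf_of_isCycleGraph (hG : IsCycleGraph G) (T : Finset V) (hT : T.Nonempty) {a : V}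
    (ha : a ∉ T) :
    ∃ v ∈ T, ∀ u ∈ T, ∀ u' ∈ T, G.Adj v u → G.Adj v u' → u = u' := by
  obtain ⟨n, hn, ⟨e⟩⟩ := hG
  obtain ⟨k, rfl⟩ : ∃ k, n = k + 2 := ⟨n - 2, by omega⟩
  -- Rotating `a` to position 0 cuts the cycle open there; take the last vertex of `T` in this
  -- order.
  obtain ⟨v, hv, hmax⟩ := T.exists_max_image (fun v => e v - e a) hT
  have key : ∀ u ∈ T, G.Adj v u → e v - e u = 1 := by
    intro u hu h
    rw [← e.map_adj_iff, SimpleGraph.cycleGraph_adj] at h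
    refine h.resolve_right fun h => ?_
    have hle := hmax u hu
    have hu' : e u - e a = e v - e a + 1 := by rw [← h]; abel
    rw [hu', ← not_lt] at hle
    -- A successor of `v` in `T` would contradict maximality unless the order wraps around, and then
    -- the successor is `a`, which is not in `T`.
    refine hle (Fin.lt_add_one_iff.2 (lt_of_le_of_ne (Fin.le_last _) fun hlast => ?_))
    rw [hlast, Fin.last_add_one, sub_eq_zero] at hu'
    exact ha (e.injective hu' ▸ hu)
  refine ⟨v, hv, fun u hu u' hu' h h' => e.injective ?_⟩
  exact sub_right_injective ((key u hu h).trans (key u' hu' h').symm)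

end PathsAndCycles

end IndepHomology

/-! ### Proof of the theorem -/

theorem theorem2 {V : Type*} [Fintype V] [LinearOrder V] (G : SimpleGraph V)
    (hG : IndepHomology.IsPathGraph G ∨ IndepHomology.IsCycleGraph G) (p : ℕ) :
    (Limits.IsZero (IndepHomology.E1 G p p) ↔
        ¬ ∃ I : Finset V, IndepHomology.IsMaximalIndepSet G I ∧ I.card = p) ∧
      ((¬ ∃ I : Finset V, IndepHomology.IsMaximalIndepSet G I ∧ I.card = p) →
        ∀ q : ℕ, 0 < q →
          Limits.IsZero (IndepHomology.E1 G p q) ∧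
          ∀ U : Finset V, G.IsIndepSet (U : Set V) → U.card = q →
            Limits.IsZero
              (IndepHomology.reducedHomology
                (IndepHomology.indComplex (IndepHomology.deleteClosedNbhd G (U : Set V)))
                ((p : ℤ) - (q : ℤ) - 1))) := by
  classical
  open IndepHomology in
  refine ⟨⟨?_, fun hp => isZero_E1_of_isExactOn fun U hU hUp _ => ?_⟩, fun hp q hq => ?_⟩
  · rintro h ⟨I, hI, rfl⟩
    exact not_isZero_E1_of_maximal hI h
  · rw [Nat.sub_self]
    exact isExactOn_zero (freeVertices_nonempty hU fun h => hp ⟨U, h, hUp⟩)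
  have hleaf : ∀ U : Finset V, U.card = q → ∀ T ⊆ freeVertices G U, T.Nonempty →
      ∃ v ∈ T, ∀ u ∈ T, ∀ u' ∈ T, G.Adj v u → G.Adj v u' → u = u' := by
    intro U hUq T hTU hT
    rcases hG with hG | hG
    · exact exists_leaf_of_isPathGraph hG T hT
    -- Here `q > 0` is essential: a vertex of `U` is missing from `T`, so the cycle is cut open.
    · obtain ⟨a, ha⟩ := Finset.card_pos.1 (hUq ▸ hq)
      exact exists_leaf_of_isCycleGraph hG T hT fun haT =>
        (mem_freeVertices.1 (hTU haT) a ha).1 rfl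
  have hdom : ∀ U : Finset V, G.IsIndepSet (U : Set V) → U.card = q → ∀ d, q + d = p →
      ¬ ∃ I ⊆ freeVertices G U, G.IsIndepSet (I : Set V) ∧ I.card = d ∧
        ∀ v ∈ freeVertices G U, v ∉ I → ∃ u ∈ I, G.Adj u v := by
    rintro U hU hUq d hd ⟨I, hIU, hI, hId, h⟩
    refine hp ⟨U ∪ I, isMaximalIndepSet_union hU hI hIU h, ?_⟩
    rw [Finset.card_union_of_disjoint (disjoint_of_subset_freeVertices hIU), hUq, hId, hd]
  refine ⟨isZero_E1_of_isExactOn fun U hU hUq hqp => ?_, fun U hU hUq => ?_⟩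
  · exact isExactOn_of_leaves _ _ (hleaf U hUq) (hdom U hU hUq _ (by omega))
  -- The leaf and maximality conditions are transported along the inclusion of the vertices of G -
  -- N[U] into `V`.
  · have hfree : ∀ v : ((closedNbhd G (U : Set V))ᶜ : Set V), v.1 ∈ freeVertices G U :=
      fun v => Finset.mem_filter.2 ⟨Finset.mem_univ _, v.2⟩
    have hsub : ∀ S : Finset ((closedNbhd G (U : Set V))ᶜ : Set V),
        S.image Subtype.val ⊆ freeVertices G U := fun S =>
      Finset.image_subset_iff.2 fun v _ => hfree v
    refine isZero_reducedHomology _ _ fun d hd => isExactOn_of_leaves _ _ ?_ ?_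
    · intro T _ hT
      obtain ⟨v, hv, h⟩ := hleaf U hUq _ (hsub T) (hT.image _)
      obtain ⟨v, hv', rfl⟩ := Finset.mem_image.1 hv
      exact ⟨v, hv', fun u hu u' hu' h1 h2 => Subtype.ext (h u.1 (Finset.mem_image_of_mem _ hu)
        u'.1 (Finset.mem_image_of_mem _ hu') h1 h2)⟩
    · rintro ⟨I, _, hI, hId, h⟩
      refine hdom U hU hUq d (by omega) ⟨I.image Subtype.val, hsub I, ?_, ?_, ?_⟩
      · intro a ha b hb hab
        obtain ⟨a, ha', rfl⟩ := Finset.mem_image.1 (Finset.mem_coe.1 ha)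
        obtain ⟨b, hb', rfl⟩ := Finset.mem_image.1 (Finset.mem_coe.1 hb)
        exact hI ha' hb' fun h => hab (congrArg _ h)
      · rw [Finset.card_image_of_injective _ Subtype.val_injective, hId]
      · intro v hv hvI
        obtain ⟨u, hu, huv⟩ := h ⟨v, (Finset.mem_filter.1 hv).2⟩ (Finset.mem_univ _)
          fun hm => hvI (Finset.mem_image_of_mem Subtype.val hm)
        exact ⟨u.1, Finset.mem_image_of_mem _ hu, huv⟩
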